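/- Work in the Euclidean plane $\mathbb{R}^2$. Call a point or a line *constructible* if it is obtained from the two points $(0,0)$ and $(1,0)$ by finitely many applications of the following steps: 1. draw the line through two distinct constructible points; 2. take the intersection point of two distinct constructible lines that meet; 3. draw the perpendicular bisector of the segment joining two distinct constructible points; 4. draw a line bisecting an angle formed by two distinct constructible lines $l,m$ that meet (a line through their common point in which $l$ is reflected to $m$); 5. given a constructible line $l$ and constructible points $P,Q$, draw a line that passes through $Q$ and reflects $P$ onto a point of $l$, provided that there are only finitely many such lines; 6. given constructible lines $l,m$ and constructible points $P,Q$, draw a line that simultaneously reflects $P$ onto a point of $l$ and $Q$ onto a point of $m$, provided that there are only finitely many such lines. A real number $a$ is *origami constructible* if $|a|$ is the distance between two (possibly equal) constructible points. Let $\mathcal{O}\subseteq\mathbb{R}$ be the set of origami constructible numbers. **Theorem.** Let $a\in\mathbb{R}$. Then $a\in\mathcal{O}$ if and only if there are an integer $n\ge 0$ and subfields $F_0,F_1,\dots,F_n$ of $\mathbb{R}$ such that $\mathbb{Q}=F_0\le F_1\le\dots\le F_n$, $[F_i:F_{i-1}]\in\{2,3\}$ for every $1\le i\le n$, and $a\in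 F_n$. In particular, if $a\in\mathcal{O}$, then $[\mathbb{Q}(a):\mathbb{Q}]=2^r3^s$ for some integers $r,s\ge 0$. -/

import Mathlib

/-- The Euclidean plane. -/
abbrev Plane : Type := EuclideanSpace ℝ (Fin 2)

/-- A straight line of the plane: a one-dimensional affine subspace. -/
@[ext]
structure PlaneLine where
  toAffineSubspace : AffineSubspace ℝ Plane
  finrank_direction : Module.finrank ℝ toAffineSubspace.direction = 1

namespace PlaneLine

theorem nonempty (l : PlaneLine) : Nonempty l.toAffineSubspace := by
  rcases l.toAffineSubspace.eq_bot_or_nonempty with h | h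
  · have h1 := l.finrank_direction
    rw [h, AffineSubspace.direction_bot, finrank_bot] at h1
    exact absurd h1 (by norm_num)
  · exact h.to_subtype

instance (l : PlaneLine) : Nonempty l.toAffineSubspace := l.nonempty

instance : Membership Plane PlaneLine := ⟨fun l P => P ∈ l.toAffineSubspace⟩

/-- The mirror image of the point `P` in the line `b`, that is, the place where `P` lands when the
paper is folded along `b`. -/
noncomputable def reflect (b : PlaneLine) (P : Plane) : Plane :=
  EuclideanGeometry.reflection b.toAffineSubspace P

/-- `b` bisects one of the angles formed by the two distinct lines `l` and `m`, which meet in a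
point: `b` passes through that point, and the reflection in `b` carries `l` to `m`. -/
def BisectsAngle (b l m : PlaneLine) : Prop :=
  l ≠ m ∧ (∃ X : Plane, X ∈ l ∧ X ∈ m ∧ X ∈ b) ∧ ∀ P : Plane, P ∈ l ↔ b.reflect P ∈ m

end PlaneLine

/-- The lines passing through `Q` and reflecting `P` onto `l`. -/
def foldsThrough (P : Plane) (l : PlaneLine) (Q : Plane) : Set PlaneLine :=
  {b | Q ∈ b ∧ b.reflect P ∈ l}

/-- The lines reflecting simultaneously `P` onto `l` and `Q` onto `m`. -/
def simultaneousFolds (P : Plane) (l : PlaneLine) (Q : Plane) (m : PlaneLine) : Set PlaneLine :=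
  {b | b.reflect P ∈ l ∧ b.reflect Q ∈ m}

/-- The objects that paper folding produces: points and lines. -/
inductive PlaneFigure : Type
  | point (P : Plane) : PlaneFigure
  | line (l : PlaneLine) : PlaneFigure

/-- The points and lines obtained from the end points `(0, 0)` and `(1, 0)` of the unit segment by
finitely many folding steps.  The last two steps apply when the required line is determined up to
finitely many possibilities; without this (for instance for `P = Q` and `l = m` in the last step)
every tangent of a parabola, and so every real number, could be constructed. -/
inductive OrigamiConstructible : PlaneFigure → Prop
  | origin : OrigamiConstructible (.point !₂[0, 0])
  | unit : OrigamiConstructible (.point !₂[1, 0])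
  | lineThrough {P Q : Plane} {b : PlaneLine}
      (hP : OrigamiConstructible (.point P)) (hQ : OrigamiConstructible (.point Q))
      (hne : P ≠ Q) (hPb : P ∈ b) (hQb : Q ∈ b) :
      OrigamiConstructible (.line b)
  | intersection {l m : PlaneLine} {P : Plane}
      (hl : OrigamiConstructible (.line l)) (hm : OrigamiConstructible (.line m))
      (hne : l ≠ m) (hPl : P ∈ l) (hPm : P ∈ m) :
      OrigamiConstructible (.point P)
  | perpBisector {P Q : Plane} {b : PlaneLine}
      (hP : OrigamiConstructible (.point P)) (hQ : OrigamiConstructible (.point Q))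
      (hne : P ≠ Q) (hb : b.toAffineSubspace = AffineSubspace.perpBisector P Q) :
      OrigamiConstructible (.line b)
  | angleBisector {l m b : PlaneLine}
      (hl : OrigamiConstructible (.line l)) (hm : OrigamiConstructible (.line m))
      (hb : b.BisectsAngle l m) :
      OrigamiConstructible (.line b)
  | foldThrough {P Q : Plane} {l b : PlaneLine}
      (hP : OrigamiConstructible (.point P)) (hl : OrigamiConstructible (.line l))
      (hQ : OrigamiConstructible (.point Q))
      (hfin : (foldsThrough P l Q).Finite) (hb : b ∈ foldsThrough P l Q) :
      OrigamiConstructible (.line b)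
  | simultaneousFold {P Q : Plane} {l m b : PlaneLine}
      (hP : OrigamiConstructible (.point P)) (hl : OrigamiConstructible (.line l))
      (hQ : OrigamiConstructible (.point Q)) (hm : OrigamiConstructible (.line m))
      (hfin : (simultaneousFolds P l Q m).Finite) (hb : b ∈ simultaneousFolds P l Q m) :
      OrigamiConstructible (.line b)

/-- The set of origami constructible real numbers: `x` such that a segment of length `|x|` can be
constructed, i.e. `|x|` is the distance of two constructible points. -/
def origamiNumbers : Set ℝ :=
  {x | ∃ P Q : Plane, OrigamiConstructible (.point P) ∧ OrigamiConstructible (.point Q) ∧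
    dist P Q = |x|}

/-! Both sides of the equivalence describe the smallest cubic closed subfield of `ℝ`, one that
contains every real root of a nonzero polynomial of degree at most three over it.

Folding does not leave a cubic closed field `K`. For a fold `u x + v y = e`, sending a given point
to a given line is an equation homogeneous of degree two in `(u, v, e)` and linear in `e`
(`reflect_mem_iff`). Eliminating `e` leaves a quadratic form in `(u, v)` for a fold through a point
and a cubic form for a simultaneous fold. A nonzero form over `K` puts the ratio `u : v` in `K`; a
zero form gives infinitely many folds, which the finiteness condition excludes. This yields
`OrigamiConstructible.isDefinedOver`.

Conversely, perpendiculars and the diagonal make the constructible abscissas a field, and one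
simultaneous fold has any root of a prescribed monic cubic as coefficient
(`isCubicClosed_origamiField`).

Finally, towers of quadratic and cubic steps are directed (`exists_le_le`), so their union is a
cubic closed field; it lies in every other one because elements of each step are cubic roots over
the previous field. -/

namespace PlaneLine

/-! ### Equations of lines and reflections in coordinates. -/

theorem mem_toAffineSubspace {l : PlaneLine} {X : Plane} : X ∈ l.toAffineSubspace ↔ X ∈ l :=
  Iff.rfl

theorem ext_mem {l m : PlaneLine} (h : ∀ X : Plane, X ∈ l ↔ X ∈ m) : l = m :=
  PlaneLine.ext (AffineSubspace.ext h)

/-- The line `l` is the line with equation `u x + v y = c`. -/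
def HasEquation (l : PlaneLine) (u v c : ℝ) : Prop :=
  (u ≠ 0 ∨ v ≠ 0) ∧ ∀ X : Plane, X ∈ l ↔ u * X 0 + v * X 1 = c

theorem sq_add_sq_ne_zero {u v : ℝ} (h : u ≠ 0 ∨ v ≠ 0) : u ^ 2 + v ^ 2 ≠ 0 := by
  rcases h with h | h <;> positivity

theorem exists_smul_of_orthogonal {a b x y : ℝ} (h : a ≠ 0 ∨ b ≠ 0) (hxy : a * x + b * y = 0) :
    ∃ k : ℝ, x = k * -b ∧ y = k * a := by
  have h0 := sq_add_sq_ne_zero h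
  refine ⟨(a * y - b * x) / (a ^ 2 + b ^ 2), ?_, ?_⟩
  · field_simp
    linear_combination a * hxy
  · field_simp
    linear_combination b * hxy

theorem exists_hasEquation (l : PlaneLine) : ∃ u v c : ℝ, l.HasEquation u v c := by
  obtain ⟨⟨d, hd⟩, hd0, hspan⟩ := finrank_eq_one_iff'.1 l.finrank_direction
  obtain ⟨X, hX⟩ := l.nonempty
  have hd0' : -d 1 ≠ 0 ∨ d 0 ≠ 0 := by
    by_contra! h
    apply hd0
    ext i
    fin_cases i
    · simpa using h.2
    · simpa using h.1
  refine ⟨-d 1, d 0, -d 1 * X 0 + d 0 * X 1, hd0', fun Y => ?_⟩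
  rw [← mem_toAffineSubspace, ← AffineSubspace.vsub_right_mem_direction_iff_mem hX]
  constructor
  · intro hY
    obtain ⟨k, hk⟩ := hspan ⟨_, hY⟩
    have hk' : k • d = Y - X := congrArg Subtype.val hk
    have h0 := congrFun (congrArg WithLp.ofLp hk') 0
    have h1 := congrFun (congrArg WithLp.ofLp hk') 1
    simp at h0 h1
    linear_combination d 1 * h0 - d 0 * h1
  · intro hY
    obtain ⟨k, h0, h1⟩ := exists_smul_of_orthogonal (x := Y 0 - X 0) (y := Y 1 - X 1) hd0'
      (by linear_combination hY)
    have : Y -ᵥ X = (-k) • d := by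
      ext i
      fin_cases i
      · simpa using h0
      · simpa using h1
    rw [this]
    exact Submodule.smul_mem _ _ hd

theorem exists_of_equation {u v : ℝ} (c : ℝ) (h : u ≠ 0 ∨ v ≠ 0) :
    ∃ l : PlaneLine, l.HasEquation u v c := by
  have h0 := sq_add_sq_ne_zero h
  let X : Plane := !₂[u * c / (u ^ 2 + v ^ 2), v * c / (u ^ 2 + v ^ 2)]
  let d : Plane := !₂[-v, u]
  have hd : d ≠ 0 := by
    intro hd
    have e0 := congrFun (congrArg WithLp.ofLp hd) 0
    have e1 := congrFun (congrArg WithLp.ofLp hd) 1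
    simp [d] at e0 e1
    tauto
  refine ⟨⟨AffineSubspace.mk' X (Submodule.span ℝ {d}), ?_⟩, h, fun Y => ?_⟩
  · rw [AffineSubspace.direction_mk', finrank_span_singleton hd]
  · rw [← mem_toAffineSubspace, AffineSubspace.mem_mk', Submodule.mem_span_singleton]
    have hX : u * X 0 + v * X 1 = c := by
      simp [X]
      field_simp
    constructor
    · rintro ⟨k, hk⟩
      have e0 := congrFun (congrArg WithLp.ofLp hk) 0
      have e1 := congrFun (congrArg WithLp.ofLp hk) 1
      simp only [d, vsub_eq_sub, PiLp.smul_apply, PiLp.sub_apply, smul_eq_mul,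
        Matrix.cons_val_zero, Matrix.cons_val_one] at e0 e1
      linear_combination hX - u * e0 - v * e1
    · intro hY
      obtain ⟨k, e0, e1⟩ := exists_smul_of_orthogonal (x := Y 0 - X 0) (y := Y 1 - X 1) h
        (by linear_combination hY - hX)
      refine ⟨k, ?_⟩
      ext i
      fin_cases i
      · simpa [d] using e0.symm
      · simpa [d] using e1.symm

/-- The line with equation `u x + v y = c`. -/
noncomputable def ofEquation (u v c : ℝ) (h : u ≠ 0 ∨ v ≠ 0) : PlaneLine :=
  (exists_of_equation c h).choose

theorem hasEquation_ofEquation (u v c : ℝ) (h : u ≠ 0 ∨ v ≠ 0) :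
    (ofEquation u v c h).HasEquation u v c :=
  (exists_of_equation c h).choose_spec

namespace HasEquation

variable {l m b : PlaneLine} {u v c u' v' c' p r q : ℝ} {P Q X : Plane}

theorem mem_iff (h : l.HasEquation u v c) : X ∈ l ↔ u * X 0 + v * X 1 = c := h.2 X

theorem smul (h : l.HasEquation u v c) {k : ℝ} (hk : k ≠ 0) :
    l.HasEquation (k * u) (k * v) (k * c) := by
  refine ⟨h.1.imp (mul_ne_zero hk) (mul_ne_zero hk), fun X => ?_⟩
  rw [h.mem_iff, ← mul_right_inj' hk]
  ring_nf

theorem unique (h : l.HasEquation u v c) (h' : m.HasEquation u v c) : l = m :=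
  ext_mem fun X => by rw [h.mem_iff, h'.mem_iff]

theorem eq_of_proportional (h : l.HasEquation u v c) (h' : m.HasEquation u' v' c') {k : ℝ}
    (hu : u = k * u') (hv : v = k * v') (hc : c = k * c') : l = m := by
  have hk : k ≠ 0 := by
    rintro rfl
    have := h.1
    simp_all
  subst hu hv hc
  exact h.unique (h'.smul hk)

theorem exists_mem (h : l.HasEquation u v c) :
    ∃ X : Plane, X ∈ l ∧ X 0 = u * c / (u ^ 2 + v ^ 2) ∧ X 1 = v * c / (u ^ 2 + v ^ 2) := by
  have h0 := sq_add_sq_ne_zero h.1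
  refine ⟨!₂[u * c / (u ^ 2 + v ^ 2), v * c / (u ^ 2 + v ^ 2)], ?_, by simp, by simp⟩
  rw [h.mem_iff]
  simp
  field_simp

/-- Compare both equations at a point `X` of the line and at its translate by the direction `(-v,
u)`. This is what shows parametrised families of folds to be injective. -/
theorem proportional (h : l.HasEquation u v c) (h' : l.HasEquation u' v' c') :
    u * v' = v * u' ∧ u * c' = u' * c ∧ v * c' = v' * c := by
  obtain ⟨X, hX, -, -⟩ := h.exists_mem
  have h1 := h.mem_iff.1 hX
  have h2 := h'.mem_iff.1 hX
  have hY : (!₂[X 0 - v, X 1 + u] : Plane) ∈ l := by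
    rw [h.mem_iff]
    simp
    linear_combination h1
  have h3 := h'.mem_iff.1 hY
  simp at h3
  have h4 : u * v' = v * u' := by linear_combination h3 - h2
  refine ⟨h4, ?_, ?_⟩
  · linear_combination X 1 * h4 + u' * h1 - u * h2
  · linear_combination -X 0 * h4 + v' * h1 - v * h2

theorem mem_direction_iff (h : l.HasEquation u v c) (w : Plane) :
    w ∈ l.toAffineSubspace.direction ↔ u * w 0 + v * w 1 = 0 := by
  obtain ⟨X, hX, -, -⟩ := h.exists_mem
  have h1 := h.mem_iff.1 hX
  have : (w +ᵥ X) -ᵥ X = w := by simp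
  rw [← this, AffineSubspace.vsub_right_mem_direction_iff_mem hX, mem_toAffineSubspace, this,
    h.mem_iff]
  simp only [vadd_eq_add, PiLp.add_apply]
  constructor <;> intro h2 <;> linarith

theorem reflect_eq (h : b.HasEquation u v c) (P : Plane) :
    b.reflect P = !₂[P 0 - 2 * ((u * P 0 + v * P 1 - c) / (u ^ 2 + v ^ 2)) * u,
      P 1 - 2 * ((u * P 0 + v * P 1 - c) / (u ^ 2 + v ^ 2)) * v] := by
  have h0 := sq_add_sq_ne_zero h.1
  -- `P - k (u, v)` is the foot of the perpendicular from `P` to `b`.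
  set k := (u * P 0 + v * P 1 - c) / (u ^ 2 + v ^ 2) with hk
  have hF : (!₂[P 0 - k * u, P 1 - k * v] : Plane) ∈ b := by
    rw [h.mem_iff, hk]
    simp
    field_simp
    ring
  have hw : (!₂[k * u, k * v] : Plane) ∈ b.toAffineSubspace.directionᗮ := by
    rw [Submodule.mem_orthogonal]
    intro w hw
    rw [h.mem_direction_iff] at hw
    simp [PiLp.inner_apply]
    linear_combination k * hw
  have hP : P = (!₂[k * u, k * v] : Plane) +ᵥ (!₂[P 0 - k * u, P 1 - k * v] : Plane) := by
    ext i
    fin_cases i <;> simp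
  have := EuclideanGeometry.reflection_orthogonal_vadd hF hw
  rw [← hP] at this
  rw [reflect, this]
  ext i
  fin_cases i <;> simp <;> ring

theorem reflect_mem_iff (hb : b.HasEquation u v c) (hl : l.HasEquation p r q) :
    b.reflect P ∈ l ↔ (p * P 0 + r * P 1 - q) * (u ^ 2 + v ^ 2)
      - 2 * (u * P 0 + v * P 1 - c) * (p * u + r * v) = 0 := by
  have h0 := sq_add_sq_ne_zero hb.1
  rw [hl.mem_iff, hb.reflect_eq]
  simp only [Matrix.cons_val_zero, Matrix.cons_val_one]
  rw [← mul_left_inj' h0, ← sub_eq_zero]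
  field_simp
  ring_nf

end HasEquation

end PlaneLine

/-! ### Folding constructions stay inside a cubic closed field. -/

/-- A subfield of `ℝ` is cubic closed if it contains every real root of every nonzero polynomial of
degree at most three with coefficients in it. -/
def Subfield.IsCubicClosed (K : Subfield ℝ) : Prop :=
  ∀ a ∈ K, ∀ b ∈ K, ∀ c ∈ K, ∀ d ∈ K, (a ≠ 0 ∨ b ≠ 0 ∨ c ≠ 0 ∨ d ≠ 0) →
    ∀ x : ℝ, a * x ^ 3 + b * x ^ 2 + c * x + d = 0 → x ∈ K

/-- A line is defined over `K` if it has an equation with coefficients in `K`. -/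
def PlaneLine.IsDefinedOver (l : PlaneLine) (K : Subfield ℝ) : Prop :=
  ∃ u v c : ℝ, u ∈ K ∧ v ∈ K ∧ c ∈ K ∧ l.HasEquation u v c

/-- A point or line is defined over `K` if it has coordinates, or an equation, in `K`. -/
def PlaneFigure.IsDefinedOver (K : Subfield ℝ) : PlaneFigure → Prop
  | .point P => P 0 ∈ K ∧ P 1 ∈ K
  | .line l => l.IsDefinedOver K

section DefinedOver

variable {K : Subfield ℝ}

/-- Dehomogenise: `u / v` is a root of a cubic over `K`, and for `v = 0` the normal may be taken as
`(1, 0)`. The constant term is still uncontrolled. -/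
theorem PlaneLine.HasEquation.exists_of_cubicForm (hK : K.IsCubicClosed) {b : PlaneLine}
    {u v e : ℝ} (hb : b.HasEquation u v e) {A B C D : ℝ} (hA : A ∈ K) (hB : B ∈ K) (hC : C ∈ K)
    (hD : D ∈ K) (h0 : A ≠ 0 ∨ B ≠ 0 ∨ C ≠ 0 ∨ D ≠ 0)
    (h : A * u ^ 3 + B * u ^ 2 * v + C * u * v ^ 2 + D * v ^ 3 = 0) :
    ∃ u' v' e' : ℝ, u' ∈ K ∧ v' ∈ K ∧ b.HasEquation u' v' e' := by
  by_cases hv : v = 0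
  · have hu : u ≠ 0 := hb.1.resolve_right (not_not.2 hv)
    have := hb.smul (inv_ne_zero hu)
    rw [hv, mul_zero, inv_mul_cancel₀ hu] at this
    exact ⟨_, _, _, K.one_mem, K.zero_mem, this⟩
  · have := hb.smul (inv_ne_zero hv)
    rw [inv_mul_cancel₀ hv] at this
    refine ⟨_, _, _, hK A hA B hB C hC D hD h0 _ ?_, K.one_mem, this⟩
    field_simp
    linear_combination h

namespace PlaneLine

variable {l m b : PlaneLine} {P Q X : Plane}

theorem exists_of_quadraticForm (hK : K.IsCubicClosed) {u v e : ℝ} (hb : b.HasEquation u v e)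
    {A B C : ℝ} (hA : A ∈ K) (hB : B ∈ K) (hC : C ∈ K) (h0 : A ≠ 0 ∨ B ≠ 0 ∨ C ≠ 0)
    (h : A * u ^ 2 + B * u * v + C * v ^ 2 = 0) :
    ∃ u' v' e' : ℝ, u' ∈ K ∧ v' ∈ K ∧ b.HasEquation u' v' e' :=
  hb.exists_of_cubicForm hK hA hB hC K.zero_mem (by tauto) (by linear_combination u * h)

theorem isDefinedOver_of_mem {u v e : ℝ} (hu : u ∈ K) (hv : v ∈ K) (hb : b.HasEquation u v e)
    (hP : P 0 ∈ K ∧ P 1 ∈ K) (hPb : P ∈ b) : b.IsDefinedOver K := by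
  refine ⟨u, v, e, hu, hv, ?_, hb⟩
  rw [← hb.mem_iff.1 hPb]
  exact add_mem (mul_mem hu hP.1) (mul_mem hv hP.2)

theorem sub_ne_zero_or_sub_ne_zero (hne : P ≠ Q) : P 0 - Q 0 ≠ 0 ∨ P 1 - Q 1 ≠ 0 := by
  by_contra! h
  apply hne
  ext i
  fin_cases i
  · exact sub_eq_zero.1 h.1
  · exact sub_eq_zero.1 h.2

theorem hasEquation_of_mem_of_mem (hne : P ≠ Q) (hPb : P ∈ b) (hQb : Q ∈ b) :
    b.HasEquation (-(P 1 - Q 1)) (P 0 - Q 0) (-(P 1 - Q 1) * P 0 + (P 0 - Q 0) * P 1) := by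
  obtain ⟨u, v, e, hb⟩ := b.exists_hasEquation
  have h1 := hb.mem_iff.1 hPb
  have h2 := hb.mem_iff.1 hQb
  obtain ⟨k, hu, hv⟩ := exists_smul_of_orthogonal (x := u) (y := v)
    (sub_ne_zero_or_sub_ne_zero hne) (by linear_combination h1 - h2)
  have hk : k ≠ 0 := by
    rintro rfl
    exact hb.1.elim (· (by rw [hu, zero_mul])) (· (by rw [hv, zero_mul]))
  have hb' := hb.smul (inv_ne_zero hk)
  rw [← h1, hu, hv, mul_assoc, mul_assoc k, ← mul_add, inv_mul_cancel_left₀ hk,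
    inv_mul_cancel_left₀ hk, inv_mul_cancel_left₀ hk] at hb'
  exact hb'

theorem eq_of_mem_of_mem (hne : P ≠ Q) (hPl : P ∈ l) (hQl : Q ∈ l) (hPm : P ∈ m) (hQm : Q ∈ m) :
    l = m :=
  (hasEquation_of_mem_of_mem hne hPl hQl).unique (hasEquation_of_mem_of_mem hne hPm hQm)

theorem isDefinedOver_of_mem_of_mem (hP : P 0 ∈ K ∧ P 1 ∈ K) (hQ : Q 0 ∈ K ∧ Q 1 ∈ K)
    (hne : P ≠ Q) (hPb : P ∈ b) (hQb : Q ∈ b) : b.IsDefinedOver K :=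
  isDefinedOver_of_mem (neg_mem (sub_mem hP.2 hQ.2)) (sub_mem hP.1 hQ.1)
    (hasEquation_of_mem_of_mem hne hPb hQb) hP hPb

theorem mem_of_mem_of_mem (hl : l.IsDefinedOver K) (hm : m.IsDefinedOver K) (hne : l ≠ m)
    (hPl : P ∈ l) (hPm : P ∈ m) : P 0 ∈ K ∧ P 1 ∈ K := by
  obtain ⟨u, v, e, hu, hv, he, hl⟩ := hl
  obtain ⟨u', v', e', hu', hv', he', hm⟩ := hm
  have h1 := hl.mem_iff.1 hPl
  have h2 := hm.mem_iff.1 hPm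
  -- With zero determinant the normals are proportional, and the common point `P` makes the constant
  -- terms proportional too, so `l = m`. Cramer's rule does the rest.
  have hdet : u * v' - v * u' ≠ 0 := by
    intro h
    obtain ⟨k, h3, h4⟩ := exists_smul_of_orthogonal (a := -v') (b := u') (x := u) (y := v)
      (by simpa [or_comm] using hm.1) (by linear_combination -h)
    apply hne
    refine hl.eq_of_proportional hm (k := -k) (by linear_combination h3) (by linear_combination h4)
      ?_
    rw [← h1, ← h2, h3, h4]
    ring
  have hdetK := sub_mem (mul_mem hu hv') (mul_mem hv hu')
  constructor
  · have : P 0 = (e * v' - v * e') / (u * v' - v * u') := by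
      rw [eq_div_iff hdet]
      linear_combination v' * h1 - v * h2
    rw [this]
    exact div_mem (sub_mem (mul_mem he hv') (mul_mem hv he')) hdetK
  · have : P 1 = (u * e' - e * u') / (u * v' - v * u') := by
      rw [eq_div_iff hdet]
      linear_combination -u' * h1 + u * h2
    rw [this]
    exact div_mem (sub_mem (mul_mem hu he') (mul_mem he hu')) hdetK

theorem hasEquation_perpBisector (hb : b.toAffineSubspace = AffineSubspace.perpBisector P Q)
    (hne : P ≠ Q) :
    b.HasEquation (2 * (Q 0 - P 0)) (2 * (Q 1 - P 1))
      (Q 0 ^ 2 + Q 1 ^ 2 - P 0 ^ 2 - P 1 ^ 2) := by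
  refine ⟨?_, fun X => ?_⟩
  · by_contra! h
    apply hne
    ext i
    fin_cases i
    · simp; linarith [h.1]
    · simp; linarith [h.2]
  · rw [← mem_toAffineSubspace, hb, AffineSubspace.mem_perpBisector_iff_inner_eq_inner]
    simp [PiLp.inner_apply]
    constructor <;> intro h <;> linarith

/-- Substituting `e = u Q₀ + v Q₁` in the folding equation gives a quadratic form in `(u, v)`; `h0`
says that one of its coefficients is nonzero. -/
theorem isDefinedOver_of_mem_foldsThrough (hK : K.IsCubicClosed) (hP : P 0 ∈ K ∧ P 1 ∈ K)
    (hQ : Q 0 ∈ K ∧ Q 1 ∈ K) {p r q : ℝ} (hp : p ∈ K) (hr : r ∈ K) (hq : q ∈ K)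
    (hl : l.HasEquation p r q) (hb : b ∈ foldsThrough P l Q)
    (h0 : (p * P 0 + r * P 1 - q) - 2 * (P 0 - Q 0) * p ≠ 0 ∨
      -2 * ((P 0 - Q 0) * r + (P 1 - Q 1) * p) ≠ 0 ∨
      (p * P 0 + r * P 1 - q) - 2 * (P 1 - Q 1) * r ≠ 0) : b.IsDefinedOver K := by
  obtain ⟨u, v, e, hb'⟩ := b.exists_hasEquation
  have h1 := hb'.mem_iff.1 hb.1
  have h2 := (hb'.reflect_mem_iff hl).1 hb.2
  have h2K : (2 : ℝ) ∈ K := ofNat_mem K 2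
  have hlam : p * P 0 + r * P 1 - q ∈ K :=
    sub_mem (add_mem (mul_mem hp hP.1) (mul_mem hr hP.2)) hq
  have hd0 := sub_mem hP.1 hQ.1
  have hd1 := sub_mem hP.2 hQ.2
  obtain ⟨u', v', e', hu', hv', hb''⟩ := exists_of_quadraticForm hK hb'
    (sub_mem hlam (mul_mem (mul_mem h2K hd0) hp))
    (mul_mem (neg_mem h2K) (add_mem (mul_mem hd0 hr) (mul_mem hd1 hp)))
    (sub_mem hlam (mul_mem (mul_mem h2K hd1) hr)) h0
    (by rw [← h1] at h2; linear_combination h2)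
  exact isDefinedOver_of_mem hu' hv' hb'' hQ hb.1

/-- If the quadratic form vanishes identically, every line through `Q` is a fold. -/
theorem foldsThrough_infinite {p r q : ℝ} (hl : l.HasEquation p r q)
    (hA : (p * P 0 + r * P 1 - q) - 2 * (P 0 - Q 0) * p = 0)
    (hB : -2 * ((P 0 - Q 0) * r + (P 1 - Q 1) * p) = 0)
    (hC : (p * P 0 + r * P 1 - q) - 2 * (P 1 - Q 1) * r = 0) : (foldsThrough P l Q).Infinite := by
  have hf (t : ℝ) : (ofEquation t 1 (t * Q 0 + Q 1) (.inr one_ne_zero)).HasEquation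
    t 1 (t * Q 0 + Q 1) := hasEquation_ofEquation _ _ _ _
  refine Set.infinite_of_injective_forall_mem
    (f := fun t : ℝ => ofEquation t 1 (t * Q 0 + Q 1) (.inr one_ne_zero)) ?_ fun t => ⟨?_, ?_⟩
  · intro s t hst
    have h1 := hf s
    have h2 := hf t
    simp only at hst
    rw [hst] at h1
    linarith [(h1.proportional h2).1]
  · rw [(hf t).mem_iff]
    ring
  · rw [(hf t).reflect_mem_iff hl]
    linear_combination t ^ 2 * hA + t * hB + hC

theorem isDefinedOver_of_foldsThrough_finite (hK : K.IsCubicClosed) (hP : P 0 ∈ K ∧ P 1 ∈ K)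
    (hl : l.IsDefinedOver K) (hQ : Q 0 ∈ K ∧ Q 1 ∈ K) (hfin : (foldsThrough P l Q).Finite)
    (hb : b ∈ foldsThrough P l Q) : b.IsDefinedOver K := by
  obtain ⟨p, r, q, hp, hr, hq, hl⟩ := hl
  refine isDefinedOver_of_mem_foldsThrough hK hP hQ hp hr hq hl hb ?_
  by_contra! h
  exact foldsThrough_infinite hl h.1 h.2.1 h.2.2 hfin

theorem IsDefinedOver.exists_ne (hl : l.IsDefinedOver K) (X : Plane) :
    ∃ P : Plane, P ∈ l ∧ P ≠ X ∧ P 0 ∈ K ∧ P 1 ∈ K := by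
  obtain ⟨u, v, e, hu, hv, he, hl⟩ := hl
  obtain ⟨P, hP, h0, h1⟩ := hl.exists_mem
  have hn : u ^ 2 + v ^ 2 ∈ K := add_mem (pow_mem hu 2) (pow_mem hv 2)
  have hP0 : P 0 ∈ K := h0 ▸ div_mem (mul_mem hu he) hn
  have hP1 : P 1 ∈ K := h1 ▸ div_mem (mul_mem hv he) hn
  by_cases h : P = X
  · refine ⟨!₂[P 0 - v, P 1 + u], ?_, ?_, ?_, ?_⟩
    · rw [hl.mem_iff] at hP ⊢
      simp
      linear_combination hP
    · intro h'
      rw [← h] at h'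
      have e0 := congrFun (congrArg WithLp.ofLp h') 0
      have e1 := congrFun (congrArg WithLp.ofLp h') 1
      simp at e0 e1
      exact hl.1.elim (· e1) (· e0)
    · simpa using sub_mem hP0 hv
    · simpa using add_mem hP1 hu
  · exact ⟨P, hP, h, hP0, hP1⟩

/-- A bisector is a fold through the vertex `X` taking a `K`-point `P ≠ X` of `l` to `m`, so the
quadratic form applies once it is known to be nonzero. -/
theorem isDefinedOver_of_bisectsAngle (hK : K.IsCubicClosed) (hl : l.IsDefinedOver K)
    (hm : m.IsDefinedOver K) (hb : b.BisectsAngle l m) : b.IsDefinedOver K := by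
  obtain ⟨hne, ⟨X, hXl, hXm, hXb⟩, href⟩ := hb
  have hX := mem_of_mem_of_mem hl hm hne hXl hXm
  obtain ⟨P, hPl, hPX, hP⟩ := hl.exists_ne X
  obtain ⟨p, r, q, hp, hr, hq, hm⟩ := hm
  refine isDefinedOver_of_mem_foldsThrough hK hP hX hp hr hq hm ⟨hXb, (href P).1 hPl⟩ ?_
  by_contra! h
  obtain ⟨hA, hB, hC⟩ := h
  have h1 := hm.mem_iff.1 hXm
  -- Evaluate the zero form at `(p, r)`, that is, at the fold `m` itself: the reflection of `P` in
  -- `m` lies on `m`, hence so does `P`.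
  have h2 : (p * P 0 + r * P 1 - q) * (p ^ 2 + r ^ 2) = 0 := by
    linear_combination -p ^ 2 * hA - p * r * hB - r ^ 2 * hC + 2 * (p ^ 2 + r ^ 2) * h1
  have h3 := (mul_eq_zero.1 h2).resolve_right (sq_add_sq_ne_zero hm.1)
  have hPm : P ∈ m := hm.mem_iff.2 (sub_eq_zero.1 h3)
  exact hne (eq_of_mem_of_mem hPX hPl hXl hPm hXm)

theorem simultaneousFolds_infinite_of_parallel {p r q p' r' q' u v : ℝ} (hl : l.HasEquation p r q)
    (hm : m.HasEquation p' r' q') (hn : u ≠ 0 ∨ v ≠ 0) (h1 : p * u + r * v = 0)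
    (h2 : p' * u + r' * v = 0) (hP : p * P 0 + r * P 1 - q = 0)
    (hQ : p' * Q 0 + r' * Q 1 - q' = 0) : (simultaneousFolds P l Q m).Infinite := by
  refine Set.infinite_of_injective_forall_mem (f := fun t : ℝ => ofEquation u v t hn) ?_
    fun t => ⟨?_, ?_⟩
  · intro s t hst
    have hs := hasEquation_ofEquation u v s hn
    have ht := hasEquation_ofEquation u v t hn
    simp only at hst
    rw [hst] at hs
    obtain ⟨-, h3, h4⟩ := hs.proportional ht
    rcases hn with hn | hn
    · exact (mul_left_cancel₀ hn h3).symm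
    · exact (mul_left_cancel₀ hn h4).symm
  · rw [(hasEquation_ofEquation u v t hn).reflect_mem_iff hl, hP, h1]
    ring
  · rw [(hasEquation_ofEquation u v t hn).reflect_mem_iff hm, hQ, h2]
    ring

/-- When the eliminated cubic form is identically zero, any normal not orthogonal to `(p, r)` gives
a fold: the first condition determines `e`, and the second then follows. -/
theorem simultaneousFolds_infinite_of_forall {p r q p' r' q' : ℝ} (hl : l.HasEquation p r q)
    (hm : m.HasEquation p' r' q')
    (h : ∀ u v : ℝ, 2 * (p' * u + r' * v) * (p * u + r * v) * ((P 0 - Q 0) * u + (P 1 - Q 1) * v) -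
      ((p * P 0 + r * P 1 - q) * (p' * u + r' * v) -
        (p' * Q 0 + r' * Q 1 - q') * (p * u + r * v)) * (u ^ 2 + v ^ 2) = 0) :
    (simultaneousFolds P l Q m).Infinite := by
  have hpr := sq_add_sq_ne_zero hl.1
  have hn (t : ℝ) : p - t * r ≠ 0 ∨ r + t * p ≠ 0 := by
    by_contra! h'
    exact hpr (by linear_combination p * h'.1 + r * h'.2)
  -- The normal `(p, r) + t (-r, p)` has inner product `p ^ 2 + r ^ 2` with `(p, r)` for every `t`,
  -- so solving the first condition for `e` never divides by zero.
  let e (t : ℝ) : ℝ := (p - t * r) * P 0 + (r + t * p) * P 1 -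
    (p * P 0 + r * P 1 - q) * ((p - t * r) ^ 2 + (r + t * p) ^ 2) / (2 * (p ^ 2 + r ^ 2))
  have he (t : ℝ) : 2 * (p ^ 2 + r ^ 2) * e t =
      2 * (p ^ 2 + r ^ 2) * ((p - t * r) * P 0 + (r + t * p) * P 1) -
        (p * P 0 + r * P 1 - q) * ((p - t * r) ^ 2 + (r + t * p) ^ 2) := by
    simp only [e]
    field_simp
  have hf (t : ℝ) := hasEquation_ofEquation (p - t * r) (r + t * p) (e t) (hn t)
  refine Set.infinite_of_injective_forall_mem
    (f := fun t : ℝ => ofEquation (p - t * r) (r + t * p) (e t) (hn t)) ?_ fun t => ⟨?_, ?_⟩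
  · intro s t hst
    have h1 := hf s
    have h2 := hf t
    simp only at hst
    rw [hst] at h1
    exact mul_left_cancel₀ hpr (by linear_combination -(h1.proportional h2).1)
  · rw [(hf t).reflect_mem_iff hl]
    linear_combination he t
  · rw [(hf t).reflect_mem_iff hm]
    refine mul_left_cancel₀ hpr ?_
    linear_combination (p' * (p - t * r) + r' * (r + t * p)) * he t + h (p - t * r) (r + t * p)

theorem isDefinedOver_of_reflect_mem {p r q u v e : ℝ} (hP : P 0 ∈ K ∧ P 1 ∈ K) (hp : p ∈ K)
    (hr : r ∈ K) (hq : q ∈ K) (hu : u ∈ K) (hv : v ∈ K) (hl : l.HasEquation p r q)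
    (hb : b.HasEquation u v e) (h : b.reflect P ∈ l) (h0 : p * u + r * v ≠ 0) :
    b.IsDefinedOver K := by
  rw [hb.reflect_mem_iff hl] at h
  have h2K : (2 : ℝ) ∈ K := ofNat_mem K 2
  have he : e = u * P 0 + v * P 1 -
      (p * P 0 + r * P 1 - q) * (u ^ 2 + v ^ 2) / (2 * (p * u + r * v)) := by
    rw [eq_sub_iff_add_eq, ← eq_sub_iff_add_eq', div_eq_iff (mul_ne_zero two_ne_zero h0)]
    linear_combination h
  refine ⟨u, v, e, hu, hv, ?_, hb⟩
  rw [he]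
  exact sub_mem (add_mem (mul_mem hu hP.1) (mul_mem hv hP.2))
    (div_mem (mul_mem (sub_mem (add_mem (mul_mem hp hP.1) (mul_mem hr hP.2)) hq)
      (add_mem (pow_mem hu 2) (pow_mem hv 2)))
      (mul_mem h2K (add_mem (mul_mem hp hu) (mul_mem hr hv))))

theorem isDefinedOver_of_simultaneousFolds_finite (hK : K.IsCubicClosed)
    (hP : P 0 ∈ K ∧ P 1 ∈ K) (hl : l.IsDefinedOver K) (hQ : Q 0 ∈ K ∧ Q 1 ∈ K)
    (hm : m.IsDefinedOver K) (hfin : (simultaneousFolds P l Q m).Finite)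
    (hb : b ∈ simultaneousFolds P l Q m) : b.IsDefinedOver K := by
  obtain ⟨p, r, q, hp, hr, hq, hl⟩ := hl
  obtain ⟨p', r', q', hp', hr', hq', hm⟩ := hm
  obtain ⟨u, v, e, hb'⟩ := b.exists_hasEquation
  have h1 := (hb'.reflect_mem_iff hl).1 hb.1
  have h2 := (hb'.reflect_mem_iff hm).1 hb.2
  have h2K : (2 : ℝ) ∈ K := ofNat_mem K 2
  have hx : P 0 - Q 0 ∈ K := sub_mem hP.1 hQ.1
  have hy : P 1 - Q 1 ∈ K := sub_mem hP.2 hQ.2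
  have hs : p * P 0 + r * P 1 - q ∈ K :=
    sub_mem (add_mem (mul_mem hp hP.1) (mul_mem hr hP.2)) hq
  have ht : p' * Q 0 + r' * Q 1 - q' ∈ K :=
    sub_mem (add_mem (mul_mem hp' hQ.1) (mul_mem hr' hQ.2)) hq'
  -- The left side is the result of eliminating `e` from `h1` and `h2`; the right side exhibits its
  -- coefficients, which lie in `K`.
  have hG : ∀ u v : ℝ, 2 * (p' * u + r' * v) * (p * u + r * v) *
      ((P 0 - Q 0) * u + (P 1 - Q 1) * v) - ((p * P 0 + r * P 1 - q) * (p' * u + r' * v) -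
        (p' * Q 0 + r' * Q 1 - q') * (p * u + r * v)) * (u ^ 2 + v ^ 2) =
      (2 * (p' * p * (P 0 - Q 0)) -
        ((p * P 0 + r * P 1 - q) * p' - (p' * Q 0 + r' * Q 1 - q') * p)) * u ^ 3 +
      (2 * (p' * p * (P 1 - Q 1) + p' * r * (P 0 - Q 0) + r' * p * (P 0 - Q 0)) -
        ((p * P 0 + r * P 1 - q) * r' - (p' * Q 0 + r' * Q 1 - q') * r)) * u ^ 2 * v +
      (2 * (p' * r * (P 1 - Q 1) + r' * p * (P 1 - Q 1) + r' * r * (P 0 - Q 0)) -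
        ((p * P 0 + r * P 1 - q) * p' - (p' * Q 0 + r' * Q 1 - q') * p)) * u * v ^ 2 +
      (2 * (r' * r * (P 1 - Q 1)) -
        ((p * P 0 + r * P 1 - q) * r' - (p' * Q 0 + r' * Q 1 - q') * r)) * v ^ 3 :=
    fun u v => by ring
  obtain ⟨u', v', e', hu', hv', hb''⟩ := hb'.exists_of_cubicForm hK
    (sub_mem (mul_mem h2K (mul_mem (mul_mem hp' hp) hx)) (sub_mem (mul_mem hs hp') (mul_mem ht hp)))
    (sub_mem (mul_mem h2K (add_mem (add_mem (mul_mem (mul_mem hp' hp) hy)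
      (mul_mem (mul_mem hp' hr) hx)) (mul_mem (mul_mem hr' hp) hx)))
      (sub_mem (mul_mem hs hr') (mul_mem ht hr)))
    (sub_mem (mul_mem h2K (add_mem (add_mem (mul_mem (mul_mem hp' hr) hy)
      (mul_mem (mul_mem hr' hp) hy)) (mul_mem (mul_mem hr' hr) hx)))
      (sub_mem (mul_mem hs hp') (mul_mem ht hp)))
    (sub_mem (mul_mem h2K (mul_mem (mul_mem hr' hr) hy)) (sub_mem (mul_mem hs hr') (mul_mem ht hr)))
    (by
      by_contra! h
      refine simultaneousFolds_infinite_of_forall hl hm (fun u v => ?_) hfin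
      rw [hG, h.1, h.2.1, h.2.2.1, h.2.2.2]
      ring)
    (by
      rw [← hG]
      linear_combination -(p' * u + r' * v) * h1 + (p * u + r * v) * h2)
  -- Either condition determines the constant term unless the fold is perpendicular to both `l` and
  -- `m`. In that case `P ∈ l` and `Q ∈ m`, so all parallels to the fold are folds too.
  by_cases h3 : p * u' + r * v' = 0
  · by_cases h4 : p' * u' + r' * v' = 0
    · exfalso
      have h1 := (hb''.reflect_mem_iff hl).1 hb.1
      have h2 := (hb''.reflect_mem_iff hm).1 hb.2
      have h0 := sq_add_sq_ne_zero hb''.1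
      rw [h3, mul_zero, sub_zero] at h1
      rw [h4, mul_zero, sub_zero] at h2
      exact simultaneousFolds_infinite_of_parallel hl hm hb''.1 h3 h4
        ((mul_eq_zero.1 h1).resolve_right h0) ((mul_eq_zero.1 h2).resolve_right h0) hfin
    · exact isDefinedOver_of_reflect_mem hQ hp' hr' hq' hu' hv' hm hb'' hb.2 h4
  · exact isDefinedOver_of_reflect_mem hP hp hr hq hu' hv' hl hb'' hb.1 h3

end PlaneLine

open PlaneLine in
/-- Every figure obtained by paper folding is defined over every cubic closed field. -/
theorem OrigamiConstructible.isDefinedOver (hK : K.IsCubicClosed) {f : PlaneFigure}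
    (hf : OrigamiConstructible f) : f.IsDefinedOver K := by
  induction hf with
  | origin => simp [PlaneFigure.IsDefinedOver, K.zero_mem]
  | unit => simp [PlaneFigure.IsDefinedOver, K.zero_mem, K.one_mem]
  | lineThrough _ _ hne hPb hQb hP hQ => exact isDefinedOver_of_mem_of_mem hP hQ hne hPb hQb
  | intersection _ _ hne hPl hPm hl hm => exact mem_of_mem_of_mem hl hm hne hPl hPm
  | perpBisector _ _ hne hb hP hQ =>
    have h2K : (2 : ℝ) ∈ K := ofNat_mem K 2
    exact ⟨_, _, _, mul_mem h2K (sub_mem hQ.1 hP.1), mul_mem h2K (sub_mem hQ.2 hP.2),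
      sub_mem (sub_mem (add_mem (pow_mem hQ.1 2) (pow_mem hQ.2 2)) (pow_mem hP.1 2))
        (pow_mem hP.2 2), hasEquation_perpBisector hb hne⟩
  | angleBisector _ _ hb hl hm => exact isDefinedOver_of_bisectsAngle hK hl hm hb
  | foldThrough _ _ _ hfin hb hP hl hQ =>
    exact isDefinedOver_of_foldsThrough_finite hK hP hl hQ hfin hb
  | simultaneousFold _ _ _ _ hfin hb hP hl hQ hm =>
    exact isDefinedOver_of_simultaneousFolds_finite hK hP hl hQ hm hfin hb

end DefinedOver

/-! ### Field arithmetic by folding. -/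

section Construction

open PlaneLine

/-- Some line with equation `u x + v y = c` is constructible by paper folding. -/
def IsConstructibleEquation (u v c : ℝ) : Prop :=
  ∃ l : PlaneLine, l.HasEquation u v c ∧ OrigamiConstructible (.line l)

/-- The point with coordinates `x` and `y` is constructible by paper folding. -/
def IsConstructiblePoint (x y : ℝ) : Prop :=
  OrigamiConstructible (.point !₂[x, y])

theorem isConstructiblePoint_iff {P : Plane} :
    IsConstructiblePoint (P 0) (P 1) ↔ OrigamiConstructible (.point P) := by
  have : (!₂[P 0, P 1] : Plane) = P := by
    ext i
    fin_cases i <;> rfl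
  rw [IsConstructiblePoint, this]

theorem point_ne {x y x' y' : ℝ} (h : x ≠ x' ∨ y ≠ y') : (!₂[x, y] : Plane) ≠ !₂[x', y'] := by
  intro h'
  have e0 := congrFun (congrArg WithLp.ofLp h') 0
  have e1 := congrFun (congrArg WithLp.ofLp h') 1
  simp at e0 e1
  exact h.elim (· e0) (· e1)

theorem PlaneLine.HasEquation.point_mem_iff {l : PlaneLine} {u v c x y : ℝ}
    (h : l.HasEquation u v c) : (!₂[x, y] : Plane) ∈ l ↔ u * x + v * y = c := by
  simpa using h.mem_iff (X := !₂[x, y])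

namespace IsConstructibleEquation

theorem smul {u v c u' v' c' : ℝ} (h : IsConstructibleEquation u v c) (k : ℝ) (hk : k ≠ 0)
    (hu : u' = k * u) (hv : v' = k * v) (hc : c' = k * c) : IsConstructibleEquation u' v' c' := by
  obtain ⟨l, hl, hcl⟩ := h
  subst hu hv hc
  exact ⟨l, hl.smul hk, hcl⟩

theorem inter {u v c u' v' c' : ℝ} (h : IsConstructibleEquation u v c)
    (h' : IsConstructibleEquation u' v' c') (hdet : u * v' - v * u' ≠ 0) {x y : ℝ}
    (hxy : u * x + v * y = c) (hxy' : u' * x + v' * y = c') : IsConstructiblePoint x y := by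
  obtain ⟨l, hl, hcl⟩ := h
  obtain ⟨m, hm, hcm⟩ := h'
  refine .intersection hcl hcm ?_ (hl.point_mem_iff.2 hxy) (hm.point_mem_iff.2 hxy')
  rintro rfl
  exact hdet (sub_eq_zero.2 (hl.proportional hm).1)

theorem of_points {x y x' y' : ℝ} (h : IsConstructiblePoint x y) (h' : IsConstructiblePoint x' y')
    (hne : x ≠ x' ∨ y ≠ y') {u v c : ℝ} (huv : u ≠ 0 ∨ v ≠ 0) (hxy : u * x + v * y = c)
    (hxy' : u * x' + v * y' = c) : IsConstructibleEquation u v c :=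
  have hl := hasEquation_ofEquation u v c huv
  ⟨_, hl, .lineThrough h h' (point_ne hne) (hl.point_mem_iff.2 hxy) (hl.point_mem_iff.2 hxy')⟩

/-- Dropping a perpendicular is a fold through `(x, y)` that keeps the point `(x₀, y₀)` of the line
on the line. The only other such fold passes through `(x₀, y₀)`; distinctness of the two points
makes it unique, so there are finitely many folds. -/
theorem perp {u v c x₀ y₀ x y : ℝ} (h : IsConstructibleEquation u v c)
    (h₀ : IsConstructiblePoint x₀ y₀) (hmem : u * x₀ + v * y₀ = c)
    (hxy : IsConstructiblePoint x y) (hne : x₀ ≠ x ∨ y₀ ≠ y) :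
    IsConstructibleEquation (-v) u (-v * x + u * y) := by
  obtain ⟨l, hl, hcl⟩ := h
  have huv : -v ≠ 0 ∨ u ≠ 0 := by simpa [or_comm] using hl.1
  have hb := hasEquation_ofEquation (-v) u (-v * x + u * y) huv
  have hne' := point_ne hne
  have hd : -(y₀ - y) ≠ 0 ∨ x₀ - x ≠ 0 := by
    simpa [sub_eq_zero, or_comm, eq_comm] using hne
  have hd' := hasEquation_ofEquation (-(y₀ - y)) (x₀ - x) (-(y₀ - y) * x + (x₀ - x) * y) hd
  refine ⟨_, hb, .foldThrough h₀ hcl hxy (Set.Finite.subset (Set.toFinite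
    {ofEquation (-v) u (-v * x + u * y) huv,
      ofEquation (-(y₀ - y)) (x₀ - x) (-(y₀ - y) * x + (x₀ - x) * y) hd}) ?_) ⟨?_, ?_⟩⟩
  · rintro b ⟨hQ, hP⟩
    obtain ⟨u', v', c', hb'⟩ := b.exists_hasEquation
    have hQ' := hb'.point_mem_iff.1 hQ
    rw [hb'.reflect_mem_iff hl] at hP
    simp only [Matrix.cons_val_zero, Matrix.cons_val_one] at hP
    have h1 : (u' * x₀ + v' * y₀ - c') * (u * u' + v * v') = 0 := by
      linear_combination -hP / 2 + (u' ^ 2 + v' ^ 2) / 2 * hmem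
    rcases mul_eq_zero.1 h1 with h1 | h1
    · right
      exact eq_of_mem_of_mem hne' (hb'.point_mem_iff.2 (sub_eq_zero.1 h1)) hQ
        (hd'.point_mem_iff.2 (by ring)) (hd'.point_mem_iff.2 (by ring))
    · left
      obtain ⟨k, h2, h3⟩ := exists_smul_of_orthogonal hl.1 h1
      exact hb'.eq_of_proportional hb h2 h3 (by rw [← hQ', h2, h3]; ring)
  · exact hb.point_mem_iff.2 rfl
  · rw [hb.reflect_mem_iff hl]
    simp only [Matrix.cons_val_zero, Matrix.cons_val_one]
    linear_combination (v ^ 2 + u ^ 2) * hmem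

end IsConstructibleEquation

open IsConstructibleEquation

theorem isConstructiblePoint_zero_zero : IsConstructiblePoint 0 0 := .origin

theorem isConstructiblePoint_one_zero : IsConstructiblePoint 1 0 := .unit

theorem isConstructibleEquation_xAxis : IsConstructibleEquation 0 1 0 :=
  of_points isConstructiblePoint_zero_zero isConstructiblePoint_one_zero (by simp) (by simp)
    (by simp) (by simp)

theorem isConstructibleEquation_yAxis : IsConstructibleEquation 1 0 0 :=
  (isConstructibleEquation_xAxis.perp isConstructiblePoint_one_zero (by simp)
    isConstructiblePoint_zero_zero (by simp)).smul (-1) (by simp) (by simp) (by simp) (by simp)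

/-- The diagonal transfers ordinates to the x-axis, so a single coordinate suffices to describe
constructibility. -/
theorem isConstructibleEquation_diagonal : IsConstructibleEquation 1 (-1) 0 := by
  obtain ⟨l, hl, hcl⟩ := isConstructibleEquation_xAxis
  obtain ⟨m, hm, hcm⟩ := isConstructibleEquation_yAxis
  have hb := hasEquation_ofEquation 1 (-1) 0 (.inl one_ne_zero)
  refine ⟨_, hb, .angleBisector hcl hcm ⟨?_, ⟨!₂[0, 0], ?_, ?_, ?_⟩, fun P => ?_⟩⟩
  · rintro rfl
    simpa using (hl.proportional hm).1
  · exact hl.point_mem_iff.2 (by simp)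
  · exact hm.point_mem_iff.2 (by simp)
  · exact hb.point_mem_iff.2 (by simp)
  · rw [hb.reflect_mem_iff hm, hl.mem_iff]
    constructor <;> intro h <;> linarith

namespace IsConstructiblePoint

variable {x y : ℝ}

theorem vertical (h : IsConstructiblePoint x y) : IsConstructibleEquation 1 0 x := by
  by_cases hx : x = 0
  · exact hx ▸ isConstructibleEquation_yAxis
  · exact (isConstructibleEquation_xAxis.perp isConstructiblePoint_zero_zero (by simp) h
      (.inl (Ne.symm hx))).smul (-1) (by simp) (by simp) (by simp) (by simp)

theorem horizontal (h : IsConstructiblePoint x y) : IsConstructibleEquation 0 1 y := by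
  by_cases hy : y = 0
  · exact hy ▸ isConstructibleEquation_xAxis
  · exact (isConstructibleEquation_yAxis.perp isConstructiblePoint_zero_zero (by simp) h
      (.inr (Ne.symm hy))).smul 1 (by simp) (by simp) (by simp) (by simp)

theorem fst (h : IsConstructiblePoint x y) : IsConstructiblePoint x 0 :=
  h.vertical.inter isConstructibleEquation_xAxis (by simp) (by simp) (by simp)

theorem snd (h : IsConstructiblePoint x y) : IsConstructiblePoint y 0 :=
  (h.horizontal.inter isConstructibleEquation_diagonal (x := y) (y := y) (by simp) (by simp)
    (by simp)).fst

theorem pair (hx : IsConstructiblePoint x 0) (hy : IsConstructiblePoint y 0) :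
    IsConstructiblePoint x y :=
  hx.vertical.inter (hy.vertical.inter isConstructibleEquation_diagonal (x := y) (y := y) (by simp)
    (by simp) (by simp)).horizontal (by simp) (by simp) (by simp)

/-- The line of slope one through `(y, 0)` has height `x - y` above `x`. -/
theorem sub (hx : IsConstructiblePoint x 0) (hy : IsConstructiblePoint y 0) :
    IsConstructiblePoint (x - y) 0 := by
  by_cases hy0 : y = 0
  · simpa [hy0] using hx
  have h1 : IsConstructibleEquation 1 1 0 :=
    (isConstructibleEquation_diagonal.perp (isConstructiblePoint_one_zero.pair
      isConstructiblePoint_one_zero) (by simp) isConstructiblePoint_zero_zero (by simp)).smul 1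
      (by simp) (by simp) (by simp) (by simp)
  have h2 : IsConstructibleEquation 1 (-1) y :=
    (h1.perp isConstructiblePoint_zero_zero (by simp) hy (.inl (Ne.symm hy0))).smul (-1)
      (by simp) (by simp) (by simp) (by simp)
  exact (h2.inter hx.vertical (x := x) (y := x - y) (by simp) (by ring) (by simp)).snd

theorem neg (hx : IsConstructiblePoint x 0) : IsConstructiblePoint (-x) 0 := by
  simpa using isConstructiblePoint_zero_zero.sub hx

theorem add (hx : IsConstructiblePoint x 0) (hy : IsConstructiblePoint y 0) :
    IsConstructiblePoint (x + y) 0 := by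
  simpa using hx.sub hy.neg

/-- The line joining the origin to `(1, x)` has height `x * y` above `y`; for the inverse, the line
to `(x, 1)` is cut above `1`. -/
theorem mul (hx : IsConstructiblePoint x 0) (hy : IsConstructiblePoint y 0) :
    IsConstructiblePoint (x * y) 0 :=
  ((of_points (u := x) (v := -1) (c := 0) isConstructiblePoint_zero_zero
    (isConstructiblePoint_one_zero.pair hx) (by simp) (by simp) (by simp) (by simp)).inter
    hy.vertical (x := y) (y := x * y) (by simp) (by ring) (by simp)).snd

theorem inv (hx : IsConstructiblePoint x 0) : IsConstructiblePoint x⁻¹ 0 := by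
  by_cases hx0 : x = 0
  · simpa [hx0] using isConstructiblePoint_zero_zero
  exact ((of_points (u := 1) (v := -x) (c := 0) isConstructiblePoint_zero_zero
    (hx.pair isConstructiblePoint_one_zero) (by simp) (by simp) (by simp) (by simp)).inter
    isConstructiblePoint_one_zero.vertical (x := 1) (y := x⁻¹) (by simpa using hx0)
    (by field_simp; ring) (by simp)).snd

end IsConstructiblePoint

/-- The field of the real numbers `x` such that the point `(x, 0)` is constructible. -/
def origamiField : Subfield ℝ where
  carrier := {x | IsConstructiblePoint x 0}
  mul_mem' hx hy := hx.mul hy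
  one_mem' := isConstructiblePoint_one_zero
  add_mem' hx hy := hx.add hy
  zero_mem' := isConstructiblePoint_zero_zero
  neg_mem' hx := hx.neg
  inv_mem' _ hx := hx.inv

theorem mem_origamiField {x : ℝ} : x ∈ origamiField ↔ IsConstructiblePoint x 0 := Iff.rfl

/-! ### Solving cubic equations by a simultaneous fold. -/

theorem finite_roots_monic_cubic (a b c : ℝ) :
    {t : ℝ | t ^ 3 + a * t ^ 2 + b * t + c = 0}.Finite := by
  open Polynomial in
  have h0 : (X ^ 3 + C a * X ^ 2 + C b * X + C c : ℝ[X]) ≠ 0 := by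
    have hm : (X ^ 3 + C a * X ^ 2 + C b * X + C c : ℝ[X]).Monic := by monicity!
    exact hm.ne_zero
  refine (Polynomial.finite_setOfPred_isRoot h0).subset fun t ht => ?_
  simpa [Polynomial.IsRoot] using ht

/-- Folds `s x + y = e` taking the origin to `y = -1` have `e = -(s ^ 2 + 1) / 2`: they are tangents
of a parabola. The point `((a - c) / 2, (b - 1) / 2)` and the line `x = (a + c) / 2` are chosen so
that the other condition becomes `s ^ 3 + a s ^ 2 + b s + c = 0`. Its finitely many roots give the
finiteness required. -/
theorem isConstructibleEquation_of_cubic {a b c t : ℝ} (ha : a ∈ origamiField)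
    (hb : b ∈ origamiField) (hc : c ∈ origamiField) (ht : t ^ 3 + a * t ^ 2 + b * t + c = 0) :
    IsConstructibleEquation t 1 (-(t ^ 2 + 1) / 2) := by
  have h2 : (2 : ℝ) ∈ origamiField := ofNat_mem _ 2
  have hP0 : (a - c) / 2 ∈ origamiField := div_mem (sub_mem ha hc) h2
  have hP1 : (b - 1) / 2 ∈ origamiField := div_mem (sub_mem hb (one_mem _)) h2
  obtain ⟨l, hl, hcl⟩ := (mem_origamiField.1 (add_mem hP0 hc)).vertical
  obtain ⟨m, hm, hcm⟩ := ((mem_origamiField.1 (zero_mem _)).pair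
    (mem_origamiField.1 (neg_mem (one_mem _)))).horizontal
  have hf (t : ℝ) := hasEquation_ofEquation t 1 (-(t ^ 2 + 1) / 2) (.inr one_ne_zero)
  refine ⟨_, hf t, .simultaneousFold (hP0.pair hP1) hcl isConstructiblePoint_zero_zero hcm
    (((finite_roots_monic_cubic a b c).image fun t =>
      ofEquation t 1 (-(t ^ 2 + 1) / 2) (.inr one_ne_zero)).subset ?_) ⟨?_, ?_⟩⟩
  · rintro d ⟨h1, h2⟩
    obtain ⟨u, v, e, hd⟩ := d.exists_hasEquation
    have hv : v ≠ 0 := by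
      rintro rfl
      rw [hd.reflect_mem_iff hm] at h2
      simp at h2
      exact hd.1.elim (· h2) (· rfl)
    have hd := hd.smul (inv_ne_zero hv)
    rw [inv_mul_cancel₀ hv] at hd
    generalize v⁻¹ * u = s at hd
    generalize v⁻¹ * e = e at hd
    rw [hd.reflect_mem_iff hl] at h1
    rw [hd.reflect_mem_iff hm] at h2
    simp only [Matrix.cons_val_zero, Matrix.cons_val_one] at h1 h2
    have he : e = -(s ^ 2 + 1) / 2 := by linear_combination h2 / 2
    subst he
    exact ⟨s, by rw [Set.mem_ofPred_eq]; linear_combination -h1, (hf s).unique hd⟩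
  · rw [(hf t).reflect_mem_iff hl]
    simp only [Matrix.cons_val_zero, Matrix.cons_val_one]
    linear_combination -ht
  · rw [(hf t).reflect_mem_iff hm]
    simp only [Matrix.cons_val_zero, Matrix.cons_val_one]
    ring

theorem mem_origamiField_of_monic_cubic {a b c t : ℝ} (ha : a ∈ origamiField)
    (hb : b ∈ origamiField) (hc : c ∈ origamiField) (ht : t ^ 3 + a * t ^ 2 + b * t + c = 0) :
    t ∈ origamiField := by
  have h := isConstructibleEquation_of_cubic ha hb hc ht
  -- The root `t` is read off as the drop in height of the fold between `x = 0` and `x = 1`.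
  have h0 : -(t ^ 2 + 1) / 2 ∈ origamiField :=
    (h.inter isConstructibleEquation_yAxis (x := 0) (by simp) (by ring) (by simp)).snd
  have h1 : -(t ^ 2 + 1) / 2 - t ∈ origamiField :=
    (h.inter isConstructiblePoint_one_zero.vertical (x := 1) (by simp) (by ring) (by simp)).snd
  simpa using sub_mem h0 h1

theorem isCubicClosed_origamiField : origamiField.IsCubicClosed := by
  intro a ha b hb c hc d hd h0 x hx
  -- Equations of lower degree are multiplied by a power of `x` to become monic cubics.
  by_cases ha0 : a = 0
  · by_cases hb0 : b = 0
    · by_cases hc0 : c = 0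
      · simp_all
      · refine mem_origamiField_of_monic_cubic (div_mem hd hc) (zero_mem _) (zero_mem _) ?_
        rw [ha0, hb0] at hx
        field_simp
        linear_combination x ^ 2 * hx
    · refine mem_origamiField_of_monic_cubic (div_mem hc hb) (div_mem hd hb) (zero_mem _) ?_
      rw [ha0] at hx
      field_simp
      linear_combination x * hx
  · refine mem_origamiField_of_monic_cubic (div_mem hb ha) (div_mem hc ha) (div_mem hd ha) ?_
    field_simp
    linear_combination hx

theorem mem_origamiNumbers_iff {a : ℝ} : a ∈ origamiNumbers ↔ a ∈ origamiField := by
  constructor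
  · rintro ⟨P, Q, hP, hQ, hd⟩
    rw [← isConstructiblePoint_iff] at hP hQ
    have hP0 : P 0 ∈ origamiField := hP.fst
    have hP1 : P 1 ∈ origamiField := hP.snd
    have hQ0 : Q 0 ∈ origamiField := hQ.fst
    have hQ1 : Q 1 ∈ origamiField := hQ.snd
    have h : a ^ 2 = (P 0 - Q 0) ^ 2 + (P 1 - Q 1) ^ 2 := by
      rw [← sq_abs, ← hd, EuclideanSpace.dist_eq, Real.sq_sqrt (by positivity)]
      simp [Real.dist_eq]
    refine isCubicClosed_origamiField 0 (zero_mem _) 1 (one_mem _) 0 (zero_mem _) _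
      (neg_mem (add_mem (pow_mem (sub_mem hP0 hQ0) 2) (pow_mem (sub_mem hP1 hQ1) 2)))
      (by simp) a ?_
    linear_combination h
  · intro ha
    refine ⟨_, _, ha, .origin, ?_⟩
    rw [EuclideanSpace.dist_eq]
    simp [Real.sqrt_sq_eq_abs]

end Construction

/-! ### Towers of quadratic and cubic extensions. -/

/-- A subfield of `ℝ` that is the top of a tower of quadratic and cubic extensions over `ℚ`. -/
inductive Subfield.IsQuadraticCubicTower : Subfield ℝ → Prop
  | base : IsQuadraticCubicTower (algebraMap ℚ ℝ).fieldRange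
  | step {F E : Subfield ℝ} (hF : IsQuadraticCubicTower F) (hle : F ≤ E)
      (hdeg : F.relfinrank E = 2 ∨ F.relfinrank E = 3) : IsQuadraticCubicTower E

namespace Subfield

variable {F E K : Subfield ℝ}

/-- The real number `x` is a root of a nonzero polynomial over `F` of degree at most three. -/
def IsCubicRoot (F : Subfield ℝ) (x : ℝ) : Prop :=
  ∃ a ∈ F, ∃ b ∈ F, ∃ c ∈ F, ∃ d ∈ F, (a ≠ 0 ∨ b ≠ 0 ∨ c ≠ 0 ∨ d ≠ 0) ∧
    a * x ^ 3 + b * x ^ 2 + c * x + d = 0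

theorem IsCubicRoot.mono {x : ℝ} (hle : F ≤ E) : F.IsCubicRoot x → E.IsCubicRoot x := by
  rintro ⟨a, ha, b, hb, c, hc, d, hd, h⟩
  exact ⟨a, hle ha, b, hle hb, c, hle hc, d, hle hd, h⟩

theorem IsCubicClosed.mem (hK : K.IsCubicClosed) {x : ℝ} : K.IsCubicRoot x → x ∈ K := by
  rintro ⟨a, ha, b, hb, c, hc, d, hd, h0, h⟩
  exact hK a ha b hb c hc d hd h0 x h

open Polynomial in
theorem isCubicRoot_of_polynomial {x : ℝ} {p : F[X]} (hp : p ≠ 0) (hdeg : p.natDegree ≤ 3)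
    (hx : aeval x p = 0) : F.IsCubicRoot x := by
  refine ⟨p.coeff 3, (p.coeff 3).2, p.coeff 2, (p.coeff 2).2, p.coeff 1, (p.coeff 1).2, p.coeff 0,
    (p.coeff 0).2, ?_, ?_⟩
  · by_contra! h
    apply hp
    ext n
    by_cases hn : n < 4
    · interval_cases n <;> simp [h]
    · rw [coeff_eq_zero_of_natDegree_lt (by omega), coeff_zero]
  · rw [aeval_eq_sum_range' (n := 4) (by omega)] at hx
    simp [Finset.sum_range_succ, Algebra.smul_def] at hx
    change (p.coeff 0 : ℝ) + p.coeff 1 * x + p.coeff 2 * x ^ 2 + p.coeff 3 * x ^ 3 = 0 at hx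
    linear_combination hx

open Polynomial in
theorem IsCubicRoot.exists_polynomial {x : ℝ} (h : F.IsCubicRoot x) :
    ∃ p : F[X], p ≠ 0 ∧ p.natDegree ≤ 3 ∧ aeval x p = 0 := by
  obtain ⟨a, ha, b, hb, c, hc, d, hd, h0, h⟩ := h
  refine ⟨C ⟨a, ha⟩ * X ^ 3 + C ⟨b, hb⟩ * X ^ 2 + C ⟨c, hc⟩ * X + C ⟨d, hd⟩, ?_,
    natDegree_cubic_le, ?_⟩
  · intro hp
    have h3 := congrArg (coeff · 3) hp
    have h2 := congrArg (coeff · 2) hp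
    have h1 := congrArg (coeff · 1) hp
    have h0' := congrArg (coeff · 0) hp
    simp [coeff_X, coeff_C] at h3 h2 h1 h0'
    simp only [Subtype.ext_iff, coe_zero] at h3 h2 h1 h0'
    tauto
  · simp only [map_add, map_mul, map_pow, aeval_X, aeval_C]
    exact h

theorem isCubicRoot_of_mem (hle : F ≤ E) (hdeg : F.relfinrank E = 2 ∨ F.relfinrank E = 3) {x : ℝ}
    (hx : x ∈ E) : F.IsCubicRoot x := by
  rw [relfinrank_eq_finrank_of_le hle] at hdeg
  -- An infinite extension would have `finrank` zero, so degree two or three entails finiteness.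
  have : FiniteDimensional F (extendScalars hle) :=
    Module.finite_of_finrank_pos (by omega)
  let y : extendScalars hle := ⟨x, hx⟩
  have hint : IsIntegral F y := Algebra.IsIntegral.isIntegral y
  have hle3 := minpoly.natDegree_le (A := F) y
  refine isCubicRoot_of_polynomial (minpoly.ne_zero hint) (by omega) ?_
  have := congrArg (algebraMap (extendScalars hle) ℝ) (minpoly.aeval F y)
  rwa [map_zero, ← Polynomial.aeval_algebraMap_apply] at this

theorem IsCubicClosed.le_of_le (hK : K.IsCubicClosed) (hFK : F ≤ K) (hle : F ≤ E)
    (hdeg : F.relfinrank E = 2 ∨ F.relfinrank E = 3) : E ≤ K :=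
  fun _ hx => hK.mem ((isCubicRoot_of_mem hle hdeg hx).mono hFK)

theorem fieldRange_algebraMap_rat_le (K : Subfield ℝ) : (algebraMap ℚ ℝ).fieldRange ≤ K := by
  rintro _ ⟨q, rfl⟩
  exact SubfieldClass.ratCast_mem K q

namespace IsQuadraticCubicTower

theorem le_of_isCubicClosed (hE : E.IsQuadraticCubicTower) (hK : K.IsCubicClosed) : E ≤ K := by
  induction hE with
  | base => exact fieldRange_algebraMap_rat_le K
  | step _ hle hdeg ih => exact hK.le_of_le ih hle hdeg

theorem exists_relfinrank_eq (hE : E.IsQuadraticCubicTower) :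
    ∃ r s : ℕ, (algebraMap ℚ ℝ).fieldRange.relfinrank E = 2 ^ r * 3 ^ s := by
  induction hE with
  | base => exact ⟨0, 0, by simp⟩
  | @step F E _ hle hdeg ih =>
    obtain ⟨r, s, h⟩ := ih
    rw [← relfinrank_mul_relfinrank (fieldRange_algebraMap_rat_le F) hle, h]
    rcases hdeg with hdeg | hdeg
    · exact ⟨r + 1, s, by rw [hdeg]; ring⟩
    · exact ⟨r, s + 1, by rw [hdeg]; ring⟩

open IntermediateField in
theorem exists_mem_of_isCubicRoot (hF : F.IsQuadraticCubicTower) {x : ℝ} (hx : F.IsCubicRoot x) :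
    ∃ E : Subfield ℝ, E.IsQuadraticCubicTower ∧ F ≤ E ∧ x ∈ E := by
  by_cases hxF : x ∈ F
  · exact ⟨F, hF, le_rfl, hxF⟩
  obtain ⟨p, hp, hp3, hpx⟩ := hx.exists_polynomial
  have hint : IsIntegral F x := IsAlgebraic.isIntegral ⟨p, hp, hpx⟩
  have hle : F ≤ F⟮x⟯.toSubfield := fun y hy => F⟮x⟯.algebraMap_mem ⟨y, hy⟩
  have hxE : x ∈ F⟮x⟯.toSubfield := mem_adjoin_simple_self F x
  refine ⟨F⟮x⟯.toSubfield, hF.step hle ?_, hle, hxE⟩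
  have hdeg : F.relfinrank F⟮x⟯.toSubfield = (minpoly F x).natDegree := by
    rw [relfinrank_eq_finrank_of_le hle]
    exact adjoin.finrank hint
  have h1 : F.relfinrank F⟮x⟯.toSubfield ≠ 1 := fun h => hxF (relfinrank_eq_one_iff.1 h hxE)
  have h2 := minpoly.natDegree_pos hint
  have h3 := (Polynomial.natDegree_le_of_dvd (minpoly.dvd F x hpx) hp).trans hp3
  omega

/-- Lift the second tower over the first step by step. A step `D ≤ E` has prime degree, so any `x`
in `E` outside `D` generates it; over `G ≥ D` this `x` is still a cubic root, and adjoining it costs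
at most one quadratic or cubic step. -/
theorem exists_le_le (hF : F.IsQuadraticCubicTower) (hE : E.IsQuadraticCubicTower) :
    ∃ G : Subfield ℝ, G.IsQuadraticCubicTower ∧ F ≤ G ∧ E ≤ G := by
  induction hE with
  | base => exact ⟨F, hF, le_rfl, fieldRange_algebraMap_rat_le F⟩
  | @step D E _ hle hdeg ih =>
    obtain ⟨G, hG, hFG, hDG⟩ := ih
    have hnot : ¬ E ≤ D := by
      rw [← relfinrank_eq_one_iff]
      omega
    obtain ⟨x, hxE, hxD⟩ := SetLike.not_le_iff_exists.1 hnot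
    obtain ⟨H, hH, hGH, hxH⟩ :=
      hG.exists_mem_of_isCubicRoot ((isCubicRoot_of_mem hle hdeg hxE).mono hDG)
    refine ⟨H, hH, hFG.trans hGH, ?_⟩
    -- Primality leaves `E ⊓ H = D` or `E ⊓ H = E`, and `x` excludes the former.
    have hmul := relfinrank_mul_relfinrank (le_inf hle (hDG.trans hGH)) (inf_le_left : E ⊓ H ≤ E)
    have hprime : (D.relfinrank E).Prime := by
      rcases hdeg with h | h <;> rw [h] <;> norm_num
    rw [← hmul, Nat.prime_mul_iff] at hprime
    rcases hprime with ⟨-, h⟩ | ⟨-, h⟩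
    · exact (relfinrank_eq_one_iff.1 h).trans inf_le_right
    · exact absurd (relfinrank_eq_one_iff.1 h ⟨hxE, hxH⟩) hxD

theorem iff_exists_fin : E.IsQuadraticCubicTower ↔
    ∃ (n : ℕ) (F : Fin (n + 1) → Subfield ℝ), F 0 = (algebraMap ℚ ℝ).fieldRange ∧
      (∀ i : Fin n, F i.castSucc ≤ F i.succ ∧
        ((F i.castSucc).relfinrank (F i.succ) = 2 ∨ (F i.castSucc).relfinrank (F i.succ) = 3)) ∧
      F (Fin.last n) = E := by
  constructor
  · intro hE
    induction hE with
    | base => exact ⟨0, fun _ => (algebraMap ℚ ℝ).fieldRange, rfl, fun i => i.elim0, rfl⟩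
    | @step D E _ hle hdeg ih =>
      obtain ⟨n, F, h0, hstep, hlast⟩ := ih
      refine ⟨n + 1, Fin.snoc (α := fun _ => Subfield ℝ) F E, ?_, fun i => ?_, by simp⟩
      · rw [← Fin.castSucc_zero, Fin.snoc_castSucc, h0]
      · induction i using Fin.lastCases with
        | last =>
          rw [Fin.snoc_castSucc, Fin.succ_last, Fin.snoc_last, hlast]
          exact ⟨hle, hdeg⟩
        | cast i =>
          rw [Fin.snoc_castSucc, Fin.succ_castSucc, Fin.snoc_castSucc]
          exact hstep i
  · rintro ⟨n, F, h0, hstep, rfl⟩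
    -- The last index is generalised, so the claim is proved for every field of the chain.
    induction Fin.last n using Fin.induction with
    | zero => exact h0 ▸ base
    | succ i ih => exact ih.step (hstep i).1 (hstep i).2

end IsQuadraticCubicTower

/-- The union of all towers of quadratic and cubic extensions of `ℚ` inside `ℝ`. -/
noncomputable def cubicClosure : Subfield ℝ := sSup {F | F.IsQuadraticCubicTower}

theorem mem_cubicClosure_iff {x : ℝ} :
    x ∈ cubicClosure ↔ ∃ F : Subfield ℝ, F.IsQuadraticCubicTower ∧ x ∈ F := by
  refine mem_sSup_of_directedOn ⟨_, .base⟩ fun F hF E hE => ?_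
  obtain ⟨G, hG, hFG, hEG⟩ := IsQuadraticCubicTower.exists_le_le hF hE
  exact ⟨G, hG, hFG, hEG⟩

theorem isCubicClosed_cubicClosure : cubicClosure.IsCubicClosed := by
  intro a ha b hb c hc d hd h0 x hx
  simp only [mem_cubicClosure_iff] at *
  obtain ⟨A, hA, ha⟩ := ha
  obtain ⟨B, hB, hb⟩ := hb
  obtain ⟨C, hC, hc⟩ := hc
  obtain ⟨D, hD, hd⟩ := hd
  obtain ⟨G, hG, hAG, hBG⟩ := hA.exists_le_le hB
  obtain ⟨H, hH, hCH, hDH⟩ := hC.exists_le_le hD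
  obtain ⟨I, hI, hGI, hHI⟩ := hG.exists_le_le hH
  obtain ⟨J, hJ, -, hxJ⟩ := hI.exists_mem_of_isCubicRoot (x := x)
    ⟨a, hGI (hAG ha), b, hGI (hBG hb), c, hHI (hCH hc), d, hHI (hDH hd), h0, hx⟩
  exact ⟨J, hJ, hxJ⟩

/-- The tower law for `ℚ(x)` inside `E`, after identifying `ℚ` with its image in `ℝ`. -/
theorem finrank_adjoin_dvd_relfinrank {x : ℝ} (hx : x ∈ E) :
    Module.finrank ℚ (IntermediateField.adjoin ℚ {x}) ∣
      (algebraMap ℚ ℝ).fieldRange.relfinrank E := by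
  let L : IntermediateField ℚ ℝ :=
    E.toIntermediateField fun q => fieldRange_algebraMap_rat_le E ⟨q, rfl⟩
  have hL : IntermediateField.adjoin ℚ {x} ≤ L :=
    IntermediateField.adjoin_simple_le_iff.2 hx
  have h1 : Module.finrank ℚ (⊥ : IntermediateField ℚ ℝ) *
      (algebraMap ℚ ℝ).fieldRange.relfinrank E = Module.finrank ℚ L := by
    rw [← IntermediateField.finrank_bot_mul_relfinrank (bot_le : ⊥ ≤ L),
      IntermediateField.relfinrank, IntermediateField.bot_toSubfield]
    rfl
  rw [IntermediateField.finrank_bot, one_mul] at h1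
  rw [h1, ← IntermediateField.finrank_bot_mul_relfinrank hL]
  exact dvd_mul_right _ _

end Subfield

/-! ### Origami numbers as the union of the towers. -/

theorem Nat.exists_eq_two_pow_mul_three_pow_of_dvd {n r s : ℕ} (h : n ∣ 2 ^ r * 3 ^ s) :
    ∃ r' s' : ℕ, n = 2 ^ r' * 3 ^ s' := by
  obtain ⟨a, b, ha, hb, rfl⟩ := exists_dvd_and_dvd_of_dvd_mul h
  obtain ⟨r', -, rfl⟩ := (Nat.dvd_prime_pow Nat.prime_two).1 ha
  obtain ⟨s', -, rfl⟩ := (Nat.dvd_prime_pow Nat.prime_three).1 hb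
  exact ⟨r', s', rfl⟩

/-- Each field is cubic closed, and each is contained in every cubic closed field. -/
theorem origamiField_eq_cubicClosure : origamiField = Subfield.cubicClosure := by
  apply le_antisymm
  · intro x hx
    have h : PlaneFigure.IsDefinedOver Subfield.cubicClosure (.point !₂[x, 0]) :=
      OrigamiConstructible.isDefinedOver Subfield.isCubicClosed_cubicClosure
        (mem_origamiField.1 hx)
    exact h.1
  · intro x hx
    obtain ⟨F, hF, hxF⟩ := Subfield.mem_cubicClosure_iff.1 hx
    exact hF.le_of_isCubicClosed isCubicClosed_origamiField hxF

theorem mem_origamiNumbers_iff_exists_tower {a : ℝ} :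
    a ∈ origamiNumbers ↔ ∃ F : Subfield ℝ, F.IsQuadraticCubicTower ∧ a ∈ F := by
  rw [mem_origamiNumbers_iff, origamiField_eq_cubicClosure, Subfield.mem_cubicClosure_iff]

theorem mainTheorem1 (a : ℝ) :
    (a ∈ origamiNumbers ↔
      ∃ (n : ℕ) (F : Fin (n + 1) → Subfield ℝ),
        F 0 = (algebraMap ℚ ℝ).fieldRange ∧
        (∀ i : Fin n, F i.castSucc ≤ F i.succ ∧
          ((F i.castSucc).relfinrank (F i.succ) = 2 ∨ (F i.castSucc).relfinrank (F i.succ) = 3)) ∧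
        a ∈ F (Fin.last n)) ∧
    (a ∈ origamiNumbers →
      ∃ r s : ℕ, Module.finrank ℚ (IntermediateField.adjoin ℚ {a}) = 2 ^ r * 3 ^ s) := by
  rw [mem_origamiNumbers_iff_exists_tower]
  refine ⟨⟨?_, ?_⟩, ?_⟩
  · rintro ⟨E, hE, ha⟩
    obtain ⟨n, F, h0, hstep, rfl⟩ := Subfield.IsQuadraticCubicTower.iff_exists_fin.1 hE
    exact ⟨n, F, h0, hstep, ha⟩
  · rintro ⟨n, F, h0, hstep, ha⟩
    exact ⟨_, Subfield.IsQuadraticCubicTower.iff_exists_fin.2 ⟨n, F, h0, hstep, rfl⟩, ha⟩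
  · rintro ⟨E, hE, ha⟩
    obtain ⟨r, s, h⟩ := hE.exists_relfinrank_eq
    exact Nat.exists_eq_two_pow_mul_three_pow_of_dvd
      (h ▸ Subfield.finrank_adjoin_dvd_relfinrank ha)
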